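/- Let $A$ be a complex Banach algebra (not necessarily unital) and let $X$ be a Banach $A$-bimodule, that is, a Banach space with associative, commuting bilinear actions satisfying $\|ax\|\le\|a\|\|x\|$ and $\|xa\|\le\|x\|\|a\|$. For $n\ge 0$ let $B^n(A,X)$ be the Banach space of bounded $n$-linear maps $A^{n}\to X$, let $\delta^n:B^n(A,X)\to B^{n+1}(A,X)$ be the connecting map $$\delta^nT(a_1,\dots,a_{n+1})=a_1T(a_2,\dots,a_{n+1})+\sum_{j=1}^n(-1)^jT(a_1,\dots,a_ja_{j+1},\dots,a_{n+1})+(-1)^{n+1}T(a_1,\dots,a_n)a_{n+1},$$ let $\mathcal Z^n(A,X)=\ker\delta^n$ be the space of bounded $n$-cocycles, and let $\mathcal H^{n+1}(A,X)=\ker\delta^{n+1}/\operatorname{im}\delta^n$ carry the quotient seminorm. For $T\in B^n(A,X)$ and a subspace $\mathcal S\subseteq B^n(A,X)$ put $$\operatorname{dist}(T,\mathcal S)=\inf_{S\in\mathcal S}\|T-S\|,\qquad \operatorname{dist}_r(T,\mathcal S)=\sup_{\|a_1\|,\dots,\|a_n\|\le1}\ \inf_{S\in\mathcal S}\|T(a_1,\dots,a_n)-S(a_1,\dots,a_n)\|;$$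 $\mathcal S$ is called hyperreflexive if there is a constant $K$ with $\operatorname{dist}(T,\mathcal S)\le K\operatorname{dist}_r(T,\mathcal S)$ for all $T\in B^n(A,X)$. Suppose that (a) $A$ has bounded local units with bound $M$: the set of those $a\in A$ for which there is $e\in A$ with $\|e\|\le M$ and $ea=ae=a$ is dense in $A$; (b) $A$ has the strong property $(\mathbb B)$ with a constant $r>0$: for each Banach space $Y$, each bounded bilinear map $\varphi:A\times A\to Y$ and each $\alpha\ge0$ such that $\|\varphi(a,b)\|\le\alpha\|a\|\|b\|$ whenever $ab=0$, one has $\|\varphi(ab,c)-\varphi(a,bc)\|\le r\alpha\|a\|\|b\|\|c\|$ for all $a,b,c\in A$; (c) $n\ge1$ and $\mathcal H^{n+1}(A,X)$ is a Banach space (equivalently, it is Hausdorff). Then there is a constant $C>0$ such that $$\operatorname{dist}(T,\mathcal Z^n(A,X))\le C\|\delta^nT\|\qquad(T\in B^n(A,X)),\tag{1}$$ and for every constant $C$ satisfying (1) and every $T\in B^n(A,X)$, $$\operatorname{dist}(T,\mathcal Z^n(A,X))\le C\,2^{n-1}\bigl(M^2r+(M+1)^2\bigr)^{n+1}\operatorname{dist}_r(T,\mathcal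 Z^n(A,X)).$$ In particular, $\mathcal Z^n(A,X)$ is hyperreflexive. -/

import Mathlib

universe u v w

namespace BoundedCocycle

/-- A Banach bimodule `X` over a (not necessarily unital) complex Banach algebra `A`: bounded
bilinear left and right actions, associative, commuting with each other, and contractive
(`‖a x‖ ≤ ‖a‖ ‖x‖` and `‖x a‖ ≤ ‖x‖ ‖a‖`). `lact a x` is `a x` and `ract a x` is `x a`. -/
class BanachBimodule (A : Type u) (X : Type v) [NonUnitalNormedRing A] [NormedSpace ℂ A]
    [NormedAddCommGroup X] [NormedSpace ℂ X] where
  /-- the left action `a x` -/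
  lact : A →L[ℂ] X →L[ℂ] X
  /-- the right action `x a` -/
  ract : A →L[ℂ] X →L[ℂ] X
  lact_mul : ∀ (a b : A) (x : X), lact (a * b) x = lact a (lact b x)
  ract_mul : ∀ (a b : A) (x : X), ract (a * b) x = ract b (ract a x)
  lact_ract : ∀ (a b : A) (x : X), lact a (ract b x) = ract b (lact a x)
  norm_lact_le : ∀ (a : A) (x : X), ‖lact a x‖ ≤ ‖a‖ * ‖x‖
  norm_ract_le : ∀ (a : A) (x : X), ‖ract a x‖ ≤ ‖x‖ * ‖a‖

/-- The Banach space `B^n(E, F)` of bounded `n`-linear maps, with its operator norm. -/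
abbrev BMul (n : ℕ) (E : Type u) (F : Type v) [NormedAddCommGroup E] [NormedSpace ℂ E]
    [NormedAddCommGroup F] [NormedSpace ℂ F] : Type (max u v) :=
  ContinuousMultilinearMap ℂ (fun _ : Fin n => E) F

/-- The strong property (B) with constant `r > 0`: whenever `φ : A × A → Y` is a bounded bilinear
map into a Banach space and `α ≥ 0` satisfies `‖φ(a,b)‖ ≤ α ‖a‖ ‖b‖` for all `a, b` with
`a b = 0`, then `‖φ(ab,c) - φ(a,bc)‖ ≤ r α ‖a‖ ‖b‖ ‖c‖` for all `a, b, c`. -/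
def HasStrongPropertyB (A : Type u) [NonUnitalNormedRing A] [NormedSpace ℂ A] (r : ℝ) : Prop :=
  0 < r ∧
    ∀ (Y : Type w) [NormedAddCommGroup Y] [NormedSpace ℂ Y] [CompleteSpace Y]
      (φ : A →L[ℂ] A →L[ℂ] Y) (α : ℝ), 0 ≤ α →
      (∀ a b : A, a * b = 0 → ‖φ a b‖ ≤ α * ‖a‖ * ‖b‖) →
      ∀ a b c : A, ‖φ (a * b) c - φ a (b * c)‖ ≤ r * α * ‖a‖ * ‖b‖ * ‖c‖

/-- `A` has bounded local units with bound `M`: the elements `a` which possess a local unit `e`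
(that is, `e a = a e = a`) of norm at most `M` are dense in `A`. -/
def HasBoundedLocalUnits (A : Type u) [NonUnitalNormedRing A] (M : ℝ) : Prop :=
  Dense {a : A | ∃ e : A, ‖e‖ ≤ M ∧ e * a = a ∧ a * e = a}

/-- `dist_r(T, S) = sup_{‖x_1‖, …, ‖x_n‖ ≤ 1} inf_{S ∈ 𝒮} ‖T(x_1,…,x_n) - S(x_1,…,x_n)‖`. -/
noncomputable def distR {n : ℕ} {E : Type u} {F : Type v} [NormedAddCommGroup E] [NormedSpace ℂ E]
    [NormedAddCommGroup F] [NormedSpace ℂ F] (T : BMul n E F)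
    (𝒮 : Submodule ℂ (BMul n E F)) : ℝ :=
  ⨆ x : {x : Fin n → E // ∀ i, ‖x i‖ ≤ 1}, ⨅ S : 𝒮, ‖T x.1 - S.1 x.1‖

/-- A subspace `𝒮` of `B^n(E, F)` is hyperreflexive if, for some constant `K`,
`dist(T, 𝒮) ≤ K dist_r(T, 𝒮)` for all `T` in `B^n(E, F)`. -/
def IsHyperreflexive {n : ℕ} {E : Type u} {F : Type v} [NormedAddCommGroup E] [NormedSpace ℂ E]
    [NormedAddCommGroup F] [NormedSpace ℂ F] (𝒮 : Submodule ℂ (BMul n E F)) : Prop :=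
  ∃ K : ℝ, ∀ T : BMul n E F, Metric.infDist T (𝒮 : Set (BMul n E F)) ≤ K * distR T 𝒮

section Complex

variable {A : Type u} {X : Type v} [NonUnitalNormedRing A] [NormedSpace ℂ A]
  [NormedAddCommGroup X] [NormedSpace ℂ X]

/-- The map `(a_0,…,a_n) ↦ a_0 T(a_1,…,a_n)`. -/
noncomputable def deltaLeft [BanachBimodule A X] {n : ℕ} (T : BMul n A X) : BMul (n + 1) A X :=
  ContinuousLinearMap.uncurryLeft (Ei := fun _ : Fin (n + 1) => A)
    (((ContinuousLinearMap.compContinuousMultilinearMapL ℂ (fun _ : Fin n => A) X X).flip T).comp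
      BanachBimodule.lact)

theorem deltaLeft_apply [BanachBimodule A X] {n : ℕ} (T : BMul n A X) (a : Fin (n + 1) → A) :
    deltaLeft T a = BanachBimodule.lact (a 0) (T (fun i => a i.succ)) := rfl

/-- The map `(a_0,…,a_n) ↦ T(a_0,…,a_{n-1}) a_n`. -/
noncomputable def deltaRight [BanachBimodule A X] {n : ℕ} (T : BMul n A X) : BMul (n + 1) A X :=
  ContinuousMultilinearMap.uncurryRight (Ei := fun _ : Fin (n + 1) => A)
    ((BanachBimodule.ract (A := A) (X := X)).flip.compContinuousMultilinearMap T)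

theorem deltaRight_apply [BanachBimodule A X] {n : ℕ} (T : BMul n A X) (a : Fin (n + 1) → A) :
    deltaRight T a = BanachBimodule.ract (a (Fin.last n)) (T (fun i => a i.castSucc)) := rfl

variable [IsScalarTower ℂ A A] [SMulCommClass ℂ A A]

theorem contractNth_update {n : ℕ} [DecidableEq (Fin (n + 1))] (j : Fin n) (a : Fin (n + 1) → A)
    (i : Fin (n + 1)) :
    ∃ (k : Fin n) (L : A →ₗ[ℂ] A), ∀ x : A,
      Fin.contractNth j.castSucc (· * ·) (Function.update a i x)
        = Function.update (Fin.contractNth j.castSucc (· * ·) a) k (L x) := by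
  have key : ∀ (k : Fin n) (x y : A),
      (Fin.contractNth j.castSucc (· * ·) (Function.update a i x) k = y) →
      (∀ l, l ≠ k → Fin.contractNth j.castSucc (· * ·) (Function.update a i x) l
        = Fin.contractNth j.castSucc (· * ·) a l) →
      Fin.contractNth j.castSucc (· * ·) (Function.update a i x)
        = Function.update (Fin.contractNth j.castSucc (· * ·) a) k y := by
    intro k x y h1 h2
    ext l
    by_cases h : l = k
    · subst h; simp [h1]
    · simp [h, h2 l h]
  rcases lt_trichotomy (i : ℕ) (j : ℕ) with h | h | h
  · refine ⟨⟨i, by omega⟩, LinearMap.id, fun x => key _ _ _ ?_ ?_⟩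
    · simp [Fin.contractNth, h]
    · intro l hl
      have hl' : (l : ℕ) ≠ i := fun h' => hl (Fin.ext h')
      simp only [Fin.contractNth, Function.update_apply, Fin.ext_iff, Fin.val_castSucc,
        Fin.val_succ, hl', if_false]
      split_ifs <;> first | rfl | omega
  · refine ⟨j, LinearMap.mulRight ℂ (a j.succ), fun x => key _ _ _ ?_ ?_⟩
    · simp [Fin.contractNth, h, Function.update_apply, Fin.ext_iff]
    · intro l hl
      have hl' : (l : ℕ) ≠ j := fun h' => hl (Fin.ext h')
      simp only [Fin.contractNth, Function.update_apply, Fin.ext_iff, Fin.val_castSucc,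
        Fin.val_succ, hl', h, if_false]
      split_ifs <;> first | rfl | omega
  · rcases eq_or_lt_of_le (Nat.succ_le_of_lt h) with h' | h'
    · refine ⟨j, LinearMap.mulLeft ℂ (a j.castSucc), fun x => key _ _ _ ?_ ?_⟩
      · simp [Fin.contractNth, ← h', Function.update_apply, Fin.ext_iff]
      · intro l hl
        have hl' : (l : ℕ) ≠ j := fun h' => hl (Fin.ext h')
        simp only [Fin.contractNth, Function.update_apply, Fin.ext_iff, Fin.val_castSucc,
          Fin.val_succ, hl', if_false]
        split_ifs <;> first | rfl | omega
    · refine ⟨⟨i - 1, by omega⟩, LinearMap.id, fun x => key _ _ _ ?_ ?_⟩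
      · have h1 : ¬ ((i : ℕ) - 1 < j) := by omega
        have h2 : ¬ ((i : ℕ) - 1 = j) := by omega
        have h3 : (i : ℕ) - 1 + 1 = i := by omega
        simp [Fin.contractNth, h1, h2, h3]
      · intro l hl
        have hl' : (l : ℕ) ≠ i - 1 := fun h' => hl (Fin.ext h')
        simp only [Fin.contractNth, Function.update_apply, Fin.ext_iff, Fin.val_castSucc,
          Fin.val_succ]
        split_ifs <;> first | rfl | omega

/-- The map `(a_0,…,a_n) ↦ T(a_0,…,a_j a_{j+1},…,a_n)`, for `0 ≤ j < n`. -/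
noncomputable def deltaMid {n : ℕ} (j : Fin n) (T : BMul n A X) : BMul (n + 1) A X where
  toFun a := T (Fin.contractNth j.castSucc (· * ·) a)
  map_update_add' := by
    intro _ a i x y
    obtain ⟨k, L, h⟩ := contractNth_update j a i
    simp only [h, map_add, ContinuousMultilinearMap.map_update_add]
  map_update_smul' := by
    intro _ a i c x
    obtain ⟨k, L, h⟩ := contractNth_update j a i
    simp only [h, map_smul, ContinuousMultilinearMap.map_update_smul]
  cont := by
    refine T.cont.comp (continuous_pi fun k => ?_)
    unfold Fin.contractNth
    split_ifs <;> fun_prop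

theorem deltaMid_apply {n : ℕ} (j : Fin n) (T : BMul n A X) (a : Fin (n + 1) → A) :
    deltaMid j T a = T (Fin.contractNth j.castSucc (· * ·) a) := rfl

variable [BanachBimodule A X]

variable (A X) in
/-- The bounded connecting map `δ^n : B^n(A, X) → B^{n+1}(A, X)`. -/
noncomputable def delta (n : ℕ) : BMul n A X →ₗ[ℂ] BMul (n + 1) A X where
  toFun T := deltaLeft T + ∑ j : Fin n, (-1 : ℂ) ^ ((j : ℕ) + 1) • deltaMid j T
    + (-1 : ℂ) ^ (n + 1) • deltaRight T
  map_add' S T := by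
    ext a
    simp only [add_apply, smul_apply,
      sum_apply, deltaLeft_apply, deltaRight_apply, deltaMid_apply, map_add, smul_add,
      Finset.sum_add_distrib]
    abel
  map_smul' c T := by
    ext a
    simp only [add_apply, smul_apply,
      sum_apply, deltaLeft_apply, deltaRight_apply, deltaMid_apply, map_smul, smul_add,
      Finset.smul_sum, smul_comm _ c, RingHom.id_apply]

/-- The connecting map is given by
`a_0 T(a_1,…,a_n) + ∑_{j<n} (-1)^(j+1) T(a_0,…,a_j a_{j+1},…,a_n) + (-1)^(n+1) T(a_0,…,a_{n-1}) a_n`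
(tuples are indexed from `0`). -/
theorem delta_apply {n : ℕ} (T : BMul n A X) (a : Fin (n + 1) → A) :
    delta A X n T a
      = BanachBimodule.lact (a 0) (T (fun i => a i.succ))
        + ∑ j : Fin n, (-1 : ℂ) ^ ((j : ℕ) + 1) • T (Fin.contractNth j.castSucc (· * ·) a)
        + (-1 : ℂ) ^ (n + 1) • BanachBimodule.ract (a (Fin.last n)) (T (fun i => a i.castSucc)) := by
  simp only [delta, LinearMap.coe_mk, AddHom.coe_mk, add_apply,
    smul_apply, sum_apply, deltaLeft_apply, deltaRight_apply,
    deltaMid_apply]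

variable (A X)

/-- The space `𝒵^n(A, X) = ker δ^n` of bounded `n`-cocycles. -/
noncomputable def cocycles (n : ℕ) : Submodule ℂ (BMul n A X) :=
  LinearMap.ker (delta A X n)

/-- The bounded coboundaries `im δ^n`, as a subspace of `𝒵^{n+1}(A, X)`. -/
noncomputable def coboundaries (n : ℕ) : Submodule ℂ (cocycles A X (n + 1)) :=
  (LinearMap.range (delta A X n)).submoduleOf (cocycles A X (n + 1))

/-- The bounded Hochschild cohomology `ℋ^{n+1}(A, X) = ker δ^{n+1} / im δ^n`, with the quotient
seminorm of the operator norm. -/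
abbrev CohomologySucc (n : ℕ) : Type (max u v) :=
  cocycles A X (n + 1) ⧸ coboundaries A X n

/-- `C` is an open-mapping constant for `δ^n`: `dist(T, 𝒵^n(A, X)) ≤ C ‖δ^n T‖` for all `T`. -/
def IsOpenMappingConstant (n : ℕ) (C : ℝ) : Prop :=
  ∀ T : BMul n A X,
    Metric.infDist T (cocycles A X n : Set (BMul n A X)) ≤ C * ‖delta A X n T‖

end Complex

end BoundedCocycle

namespace BoundedCocycle

/-! The heart is the estimate `‖δⁿT‖ ≤ (M²r + (M+1)²)^(n+1) dist_r(T, 𝒵ⁿ)` (`norm_delta_le`);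
inequality (1) then turns it into a bound for the distance.

Extend `T` by zero at scalars to the unitization and put `Ψ(x_0,…,x_{n+1}) = x_0 T(x_1,…,x_n)
x_{n+1}`. The cocycle identity forces the analogous map of a cocycle to vanish at tuples whose
consecutive products are all zero. Subtracting a cocycle chosen separately for each tuple therefore
bounds `Ψ` there by `dist_r` (`boundedOnZeroProducts_twoSided`).

Passing from `Ψ` to `(c, t) ↦ Ψ(b, c, t) - Ψ(1, bc, t)` with `b` in `A` removes one argument, and
property (B) with local units keeps the map bounded at zero products, at the cost of a factor `(M²r
+ (M+1)²)‖b‖` (`BoundedOnZeroProducts.splitHead`). After `n+1` such steps one argument and no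
product condition are left. Evaluation at `1` gives exactly `δⁿT(b_0,…,b_n)`, because `Ψ` vanishes
when an inner argument is `1` (`delta_eq_splitAll`).

A constant in (1) exists because Hausdorff cohomology means that `δⁿ` has closed range, so the open
mapping theorem applies (`exists_isOpenMappingConstant`). -/

/-- The strong property (B) transfers to bounded bilinear maps into any normed space, in any
universe: by Hahn–Banach it suffices to have it for scalar-valued maps. -/
theorem HasStrongPropertyB.norm_sub_le {A : Type u} {X : Type v} [NonUnitalNormedRing A]
    [NormedSpace ℂ A] [NormedAddCommGroup X] [NormedSpace ℂ X] {r : ℝ}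
    (hr : HasStrongPropertyB.{u, w} A r) (φ : A →L[ℂ] A →L[ℂ] X) {α : ℝ} (hα : 0 ≤ α)
    (h : ∀ a b : A, a * b = 0 → ‖φ a b‖ ≤ α * ‖a‖ * ‖b‖) (a b c : A) :
    ‖φ (a * b) c - φ a (b * c)‖ ≤ r * α * ‖a‖ * ‖b‖ * ‖c‖ := by
  obtain ⟨f, hf, hfx⟩ := exists_dual_vector'' ℂ (φ (a * b) c - φ a (b * c))
  let g : X →L[ℂ] ULift.{w} ℂ :=
    ((ContinuousLinearEquiv.ulift (R₁ := ℂ) (M₁ := ℂ)).symm : ℂ →L[ℂ] ULift.{w} ℂ).comp f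
  have hg : ∀ x, ‖g x‖ = ‖f x‖ := fun x => rfl
  have key := hr.2 (ULift.{w} ℂ) ((ContinuousLinearMap.compL ℂ A X (ULift.{w} ℂ) g).comp φ) α hα
    (fun a b hab => by
      refine le_trans ?_ (h a b hab)
      simp only [ContinuousLinearMap.comp_apply, ContinuousLinearMap.compL_apply, hg]
      exact f.le_of_opNorm_le_of_le hf le_rfl |>.trans (by rw [one_mul])) a b c
  simp only [ContinuousLinearMap.comp_apply, ContinuousLinearMap.compL_apply] at key
  rw [← map_sub, hg, hfx] at key
  simpa using key

/-! ### The bar differential -/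

section Bar

variable {B : Type u} {X : Type v} [AddCommGroup X]

/-- The bar differential `x ↦ ∑ j, (-1) ^ j F(x_0, …, x_j x_{j+1}, …)`, defined by recursion. -/
def bar [Mul B] : ∀ m : ℕ, ((Fin (m + 1) → B) → X) → (Fin (m + 2) → B) → X
  | 0, F, x => F fun _ => x 0 * x 1
  | m + 1, F, x => F (Fin.cons (x 0 * x 1) fun i => x i.succ.succ)
      - bar m (fun y => F (Fin.cons (x 0) y)) fun i => x i.succ

theorem bar_zero_cons [Mul B] (F : (Fin 1 → B) → X) (a : B) (t : Fin 1 → B) :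
    bar 0 F (Fin.cons a t) = F fun _ => a * t 0 := rfl

theorem bar_cons_cons [Mul B] {m : ℕ} (F : (Fin (m + 2) → B) → X) (a b : B)
    (t : Fin (m + 1) → B) :
    bar (m + 1) F (Fin.cons a (Fin.cons b t))
      = F (Fin.cons (a * b) t) - bar m (fun y => F (Fin.cons a y)) (Fin.cons b t) := rfl

theorem bar_sub [Mul B] {m : ℕ} (F G : (Fin (m + 1) → B) → X) (x : Fin (m + 2) → B) :
    bar m (fun y => F y - G y) x = bar m F x - bar m G x := by
  induction m with
  | zero => rfl
  | succ m ih => simp only [bar, ih]; abel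

theorem bar_zero_fun [Mul B] {m : ℕ} (x : Fin (m + 2) → B) :
    bar m (fun _ => (0 : X)) x = 0 := by
  induction m with
  | zero => rfl
  | succ m ih => simp only [bar, ih, sub_zero]

theorem exists_cons_cons {m : ℕ} (x : Fin (m + 2) → B) :
    ∃ (a b : B) (t : Fin m → B), x = Fin.cons a (Fin.cons b t) :=
  ⟨x 0, x 1, fun i => x i.succ.succ, by
    ext i; refine Fin.cases rfl (fun i => ?_) i; refine Fin.cases rfl (fun i => rfl) i⟩

/-- With the first argument frozen, the differential is a contraction into the head minus a lower
differential. The lower one dies by induction, and associativity cancels the rest. -/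
theorem bar_bar [Semigroup B] {m : ℕ} (F : (Fin (m + 1) → B) → X) (x : Fin (m + 3) → B) :
    bar (m + 1) (bar m F) x = 0 := by
  obtain ⟨a, b, t, rfl⟩ := exists_cons_cons x
  obtain ⟨c, s, rfl⟩ : ∃ (c : B) (s : Fin m → B), t = Fin.cons c s :=
    ⟨t 0, fun i => t i.succ, (Fin.cons_self_tail t).symm⟩
  induction m generalizing a b c with
  | zero =>
    rw [bar_cons_cons, bar_zero_cons, bar_zero_cons, sub_eq_zero]
    change F _ = F _
    congr 1
    funext i
    exact mul_assoc _ _ _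
  | succ m ih =>
    obtain ⟨d, s', rfl⟩ : ∃ (d : B) (s' : Fin m → B), s = Fin.cons d s' :=
      ⟨s 0, fun i => s i.succ, (Fin.cons_self_tail s).symm⟩
    have h : (fun y : Fin (m + 2) → B => bar (m + 1) F (Fin.cons a y))
        = fun y => F (Fin.cons (a * y 0) fun i => y i.succ)
            - bar m (fun z => F (Fin.cons a z)) y := rfl
    rw [bar_cons_cons, h, bar_sub, ih, sub_zero, bar_cons_cons, bar_cons_cons]
    simp only [Fin.cons_zero, Fin.cons_succ, mul_assoc, sub_self]

theorem contractNth_zero_cons_cons [Mul B] {m : ℕ} (a b : B) (t : Fin m → B) :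
    Fin.contractNth 0 (· * ·) (Fin.cons a (Fin.cons b t) : Fin (m + 2) → B)
      = Fin.cons (a * b) t := by
  ext k
  refine Fin.cases ?_ (fun k => ?_) k <;> simp [Fin.contractNth]

theorem contractNth_succ_cons [Mul B] {m : ℕ} (j : Fin (m + 1)) (a : B) (t : Fin (m + 1) → B) :
    Fin.contractNth j.succ (· * ·) (Fin.cons a t : Fin (m + 2) → B)
      = Fin.cons a (Fin.contractNth j (· * ·) t) := by
  ext k
  refine Fin.cases ?_ (fun k => ?_) k
  · simp [Fin.contractNth]
  · simp [Fin.contractNth]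

theorem bar_eq_sum [Mul B] [Module ℂ X] {m : ℕ} (F : (Fin (m + 1) → B) → X)
    (x : Fin (m + 2) → B) :
    bar m F x = ∑ j : Fin (m + 1), (-1 : ℂ) ^ (j : ℕ) •
      F (Fin.contractNth j.castSucc (· * ·) x) := by
  induction m with
  | zero =>
    rw [Fin.sum_univ_one, Fin.val_zero, pow_zero, one_smul, bar]
    congr 1
    funext k
    obtain rfl : k = 0 := Fin.fin_one_eq_zero k
    simp [Fin.contractNth]
  | succ m ih =>
    obtain ⟨a, b, t, rfl⟩ := exists_cons_cons x
    rw [bar_cons_cons, Fin.sum_univ_succ, ih]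
    simp only [Fin.castSucc_zero, contractNth_zero_cons_cons, Fin.val_zero, pow_zero, one_smul,
      ← Fin.succ_castSucc, contractNth_succ_cons, Fin.val_succ, pow_succ, mul_neg_one, neg_smul,
      Finset.sum_neg_distrib, sub_eq_add_neg]

/-- Only the contraction `1 * t 0` survives: every other term keeps the leading `1`. For `m = 0`
there are no other terms, hence the guard `0 < m`. -/
theorem bar_cons_one [MulOneClass B] {m : ℕ} (F : (Fin (m + 1) → B) → X)
    (hF : 0 < m → ∀ y, y 0 = 1 → F y = 0) (t : Fin (m + 1) → B) :
    bar m F (Fin.cons 1 t) = F t := by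
  cases m with
  | zero =>
    rw [bar_zero_cons]
    congr 1
    funext k
    obtain rfl : k = 0 := Fin.fin_one_eq_zero k
    exact one_mul _
  | succ m =>
    obtain ⟨b, s, rfl⟩ : ∃ (b : B) (s : Fin (m + 1) → B), t = Fin.cons b s :=
      ⟨t 0, fun i => t i.succ, (Fin.cons_self_tail t).symm⟩
    rw [bar_cons_cons, one_mul]
    have : (fun y : Fin (m + 1) → B => F (Fin.cons 1 y)) = fun _ => 0 := by
      funext y; exact hF m.succ_pos _ rfl
    rw [this, bar_zero_fun, sub_zero]

end Bar

/-! ### Splitting off arguments and the use of property (B) -/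

section Split

variable {A : Type u} {B : Type*} {X : Type v} [NormedRing B] [NormedAlgebra ℂ B]
  [NormedAddCommGroup X] [NormedSpace ℂ X]

/-- The map `(c, t) ↦ Ψ(b, c, t) - Ψ(1, b c, t)`. -/
noncomputable def splitHead {k : ℕ} (b : B) (Ψ : BMul (k + 2) B X) : BMul (k + 1) B X :=
  Ψ.curryLeft b - (ContinuousMultilinearMap.compContinuousLinearMap (Ψ.curryLeft 1)
    (Function.update (fun _ : Fin (k + 1) => ContinuousLinearMap.id ℂ B) 0
      (ContinuousLinearMap.mul ℂ B b)))

theorem splitHead_apply {k : ℕ} (b : B) (Ψ : BMul (k + 2) B X) (c : B) (t : Fin k → B) :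
    splitHead b Ψ (Fin.cons c t) = Ψ (Fin.cons b (Fin.cons c t))
      - Ψ (Fin.cons 1 (Fin.cons (b * c) t)) := by
  simp only [splitHead, sub_apply, ContinuousMultilinearMap.compContinuousLinearMap_apply,
    ContinuousMultilinearMap.curryLeft_apply]
  congr 3
  ext i
  refine Fin.cases ?_ (fun i => ?_) i <;> simp

/-- Splitting off the heads `b_0, b_1, …` in turn and evaluating the remaining map at `1`. -/
noncomputable def splitAll : ∀ k : ℕ, (Fin k → B) → BMul (k + 1) B X → X
  | 0, _, Ψ => Ψ fun _ => 1
  | k + 1, b, Ψ => splitAll k (fun i => b i.succ) (splitHead (b 0) Ψ)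

/-- A map which vanishes as soon as some inner argument is `1` is split into its bar
differential. -/
theorem splitAll_eq_bar {k : ℕ} (b : Fin k → B) (Ψ : BMul (k + 1) B X)
    (hΨ : ∀ x (i : Fin (k + 1)), i ≠ 0 → i ≠ Fin.last k → x i = 1 → Ψ x = 0) :
    splitAll k b Ψ = bar k Ψ (Fin.cons 1 (Fin.snoc b (1 : B) : Fin (k + 1) → B)) := by
  induction k with
  | zero =>
    rw [bar_zero_cons, one_mul]
    rfl
  | succ k ih =>
    obtain ⟨a, b, rfl⟩ : ∃ (a : B) (b' : Fin k → B), b = Fin.cons a b' :=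
      ⟨b 0, fun i => b i.succ, (Fin.cons_self_tail b).symm⟩
    simp only [splitAll, Fin.cons_zero, Fin.cons_succ]
    rw [ih]
    · have h1 : ((splitHead a Ψ : BMul (k + 1) B X) : (Fin (k + 1) → B) → X)
          = fun y => Ψ (Fin.cons a y) - Ψ (Fin.cons 1 (Fin.cons (a * y 0) fun i => y i.succ)) := by
        funext y
        obtain ⟨c, t, rfl⟩ : ∃ (c : B) (t : Fin k → B), y = Fin.cons c t :=
          ⟨y 0, fun i => y i.succ, (Fin.cons_self_tail y).symm⟩
        exact splitHead_apply a Ψ c t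
      -- A factor `a` multiplied into the first slot may as well be the first argument, in place of
      -- `1`.
      have h2 : ∀ t : Fin (k + 1) → B,
          bar k (fun y => Ψ (Fin.cons 1 (Fin.cons (a * y 0) fun i => y i.succ))) (Fin.cons 1 t)
            = bar k (fun y => Ψ (Fin.cons 1 y)) (Fin.cons a t) := by
        intro t
        cases k with
        | zero =>
          rw [bar_zero_cons, bar_zero_cons, one_mul]
          congr 2
          funext i
          obtain rfl : i = 0 := Fin.fin_one_eq_zero i
          rfl
        | succ k =>
          obtain ⟨b, s, rfl⟩ : ∃ (b : B) (s : Fin (k + 1) → B), t = Fin.cons b s :=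
            ⟨t 0, fun i => t i.succ, (Fin.cons_self_tail t).symm⟩
          rw [bar_cons_cons, bar_cons_cons]
          simp only [Fin.cons_zero, Fin.cons_succ, one_mul, mul_one]
      have h3 : (Fin.snoc (Fin.cons a b) (1 : B) : Fin (k + 2) → B)
          = Fin.cons a (Fin.snoc b (1 : B) : Fin (k + 1) → B) :=
        (Fin.cons_snoc_eq_snoc_cons (β := B) a b 1).symm
      -- The differential of `Ψ(a, ·)` at a tuple starting with `1` collapses to one value of `Ψ`,
      -- since that `1` sits in an inner slot of `Ψ` when `k > 0`.
      rw [h1, bar_sub, h2, h3, bar_cons_cons, one_mul, bar_cons_one]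
      intro hk y hy
      refine hΨ _ (Fin.succ 0) (Fin.succ_ne_zero _) (fun h => ?_) hy
      have := congrArg Fin.val h
      simp at this
      omega
    · intro x i hi hil hx
      obtain ⟨c, t, rfl⟩ : ∃ (c : B) (t : Fin k → B), x = Fin.cons c t :=
        ⟨x 0, fun i => x i.succ, (Fin.cons_self_tail x).symm⟩
      obtain ⟨j, rfl⟩ := Fin.exists_succ_eq.mpr hi
      rw [splitHead_apply, hΨ _ j.succ.succ ?_ ?_ ?_, hΨ _ j.succ.succ ?_ ?_ ?_, sub_zero]
      all_goals first
        | exact hx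
        | exact Fin.succ_ne_zero _
        | (simp only [ne_eq, Fin.ext_iff, Fin.val_succ, Fin.val_last] at hil ⊢; omega)

/-- `Ψ` is bounded by `α` at the tuples whose consecutive products vanish. -/
def BoundedOnZeroProducts {k : ℕ} (α : ℝ) (Ψ : BMul (k + 1) B X) : Prop :=
  ∀ x : Fin (k + 1) → B, (∀ i : Fin k, x i.castSucc * x i.succ = 0) → ‖Ψ x‖ ≤ α * ∏ i, ‖x i‖

theorem BoundedOnZeroProducts.norm_cons_cons_le {k : ℕ} {α : ℝ} {Ψ : BMul (k + 2) B X}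
    (hΨ : BoundedOnZeroProducts α Ψ) {y z : B} {t : Fin k → B} (hyz : y * z = 0)
    (hzt : ∀ i : Fin k, (Fin.cons z t : Fin (k + 1) → B) i.castSucc * t i = 0) :
    ‖Ψ (Fin.cons y (Fin.cons z t))‖ ≤ α * (‖y‖ * (‖z‖ * ∏ i, ‖t i‖)) := by
  refine (hΨ _ fun i => ?_).trans_eq (by simp [Fin.prod_univ_succ])
  refine Fin.cases ?_ (fun i => ?_) i
  · simpa using hyz
  · simpa [← Fin.succ_castSucc] using hzt i

variable [NonUnitalNormedRing A] [NormedSpace ℂ A]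

/-- Splitting off the head preserves boundedness at zero products: the strong property (B) of `A`
yields the property (B) for maps on a unital algebra containing `A`, at elements of `A`. -/
theorem BoundedOnZeroProducts.splitHead {M r : ℝ} (hM : HasBoundedLocalUnits A M) (hM1 : 1 ≤ M)
    (hr : HasStrongPropertyB.{u, w} A r) (hone : ‖(1 : B)‖ = 1) (ι : A →L[ℂ] B)
    (hι : ∀ a, ‖ι a‖ = ‖a‖) (hmul : ∀ a b, ι (a * b) = ι a * ι b)
    {k : ℕ} {α : ℝ} (hα : 0 ≤ α) {Ψ : BMul (k + 2) B X}
    (hΨ : BoundedOnZeroProducts α Ψ) (b : A) :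
    BoundedOnZeroProducts ((M ^ 2 * r + (M + 1) ^ 2) * α * ‖b‖)
      (BoundedCocycle.splitHead (ι b) Ψ) := by
  intro x hx
  obtain ⟨c, t, rfl⟩ : ∃ (c : B) (t : Fin k → B), x = Fin.cons c t :=
    ⟨x 0, fun i => x i.succ, (Fin.cons_self_tail x).symm⟩
  simp only [Fin.cons_succ] at hx
  -- Multiplying `c` on the left preserves the zero products to its right, so only the product of
  -- the two leading arguments remains to be controlled.
  have hx' : ∀ d : B, ∀ i : Fin k,
      (Fin.cons (d * c) t : Fin (k + 1) → B) i.castSucc * t i = 0 := by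
    intro d i
    have := hx i
    revert this
    cases k with
    | zero => exact i.elim0
    | succ k =>
      refine Fin.cases (fun h => ?_) (fun i h => ?_) i
      · simp only [Fin.castSucc_zero, Fin.cons_zero] at h ⊢
        rw [mul_assoc, h, mul_zero]
      · simpa [← Fin.succ_castSucc] using h
  refine hM.induction (P := fun b => ‖BoundedCocycle.splitHead (ι b) Ψ (Fin.cons c t)‖
      ≤ (M ^ 2 * r + (M + 1) ^ 2) * α * ‖b‖ * ∏ i, ‖(Fin.cons c t : Fin (k + 1) → B) i‖)
    ?_ ?_ b
  · rintro b ⟨e, he, heb, hbe⟩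
    let φ : B →L[ℂ] B →L[ℂ] X :=
      (ContinuousLinearMap.compL ℂ B (BMul k B X) X
        (ContinuousMultilinearMap.apply ℂ (fun _ : Fin k => B) X t)).comp
        (((continuousMultilinearCurryLeftEquiv ℂ (fun _ : Fin (k + 1) => B)
          X).toContinuousLinearEquiv : BMul (k + 1) B X →L[ℂ] (B →L[ℂ] BMul k B X)).comp
          Ψ.curryLeft)
    have hφ : ∀ y z, φ y z = Ψ (Fin.cons y (Fin.cons z t)) := fun y z => rfl
    let χ : A →L[ℂ] A →L[ℂ] X :=
      (((φ.comp ι).flip).comp (((ContinuousLinearMap.mul ℂ B).flip c).comp ι)).flip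
    have hχ : ∀ a d, χ a d = φ (ι a) (ι d * c) := fun a d => rfl
    set P := ∏ i, ‖t i‖ with hP
    have hP0 : 0 ≤ P := Finset.prod_nonneg fun i _ => norm_nonneg _
    have hbd : ∀ y d, y * (d * c) = 0 → ‖φ y (d * c)‖ ≤ α * ‖y‖ * ‖d‖ * (‖c‖ * P) := by
      intro y d h
      rw [hφ]
      refine (hΨ.norm_cons_cons_le h (hx' d)).trans ?_
      calc α * (‖y‖ * (‖d * c‖ * P)) ≤ α * (‖y‖ * ((‖d‖ * ‖c‖) * P)) := by
            gcongr; exact norm_mul_le _ _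
        _ = _ := by ring
    -- Property (B) at the triple `(e, b, e)`: since `eb = be = b`, it compares `χ b e` with `χ e b`
    -- and costs `‖e‖² ≤ M²`.
    have h1 := hr.norm_sub_le χ (α := α * (‖c‖ * P)) (by positivity) (fun a d had => by
      rw [hχ]
      refine (hbd (ι a) (ι d) ?_).trans_eq (by rw [hι, hι]; ring)
      rw [← mul_assoc, ← hmul, had, map_zero, zero_mul]) e b e
    rw [heb, hbe, hχ, hχ] at h1
    -- The errors made by replacing `1` with `e` are governed by genuine zero products, `b(1 - e) =
    -- 0 = (1 - e)b`. This is where the unit of `B` enters.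
    have h2 := hbd (ι b) (1 - ι e) (by
      rw [← mul_assoc, mul_sub, mul_one, ← hmul, hbe, sub_self, zero_mul])
    have h3 := hbd (1 - ι e) (ι b) (by
      rw [← mul_assoc, sub_mul, one_mul, ← hmul, heb, sub_self, zero_mul])
    have h4 : ‖1 - ι e‖ ≤ M + 1 := by
      refine (norm_sub_le _ _).trans ?_
      rw [hone, hι]; linarith
    have hsplit : BoundedCocycle.splitHead (ι b) Ψ (Fin.cons c t)
        = (φ (ι b) (ι e * c) - φ (ι e) (ι b * c)) + φ (ι b) ((1 - ι e) * c)
          - φ (1 - ι e) (ι b * c) := by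
      rw [splitHead_apply, ← hφ, ← hφ, sub_mul, one_mul, map_sub (φ (ι b)), map_sub φ,
        sub_apply]
      abel
    rw [hsplit]
    refine (norm_sub_le _ _).trans ((add_le_add (norm_add_le _ _) le_rfl).trans ?_)
    have h1' : ‖φ (ι b) (ι e * c) - φ (ι e) (ι b * c)‖
        ≤ M ^ 2 * r * (α * ‖b‖ * (‖c‖ * P)) := by
      refine h1.trans ?_
      have h0 := hr.1
      calc r * (α * (‖c‖ * P)) * ‖e‖ * ‖b‖ * ‖e‖
          = r * (α * (‖c‖ * P)) * ‖b‖ * (‖e‖ * ‖e‖) := by ring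
        _ ≤ r * (α * (‖c‖ * P)) * ‖b‖ * (M * M) := by gcongr
        _ = _ := by ring
    have h2' : ‖φ (ι b) ((1 - ι e) * c)‖ ≤ (M + 1) * (α * ‖b‖ * (‖c‖ * P)) := by
      refine h2.trans ?_
      rw [hι]
      calc α * ‖b‖ * ‖1 - ι e‖ * (‖c‖ * P) ≤ α * ‖b‖ * (M + 1) * (‖c‖ * P) := by gcongr
        _ = _ := by ring
    have h3' : ‖φ (1 - ι e) (ι b * c)‖ ≤ (M + 1) * (α * ‖b‖ * (‖c‖ * P)) := by
      refine h3.trans ?_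
      rw [hι]
      calc α * ‖1 - ι e‖ * ‖b‖ * (‖c‖ * P) ≤ α * (M + 1) * ‖b‖ * (‖c‖ * P) := by gcongr
        _ = _ := by ring
    have hQ : 0 ≤ α * ‖b‖ * (‖c‖ * P) := by positivity
    have hfin : (∏ i, ‖(Fin.cons c t : Fin (k + 1) → B) i‖) = ‖c‖ * P := by
      simp [Fin.prod_univ_succ, hP]
    rw [hfin]
    -- The two error terms contribute `2(M+1)`, absorbed in `(M+1)²` because `M ≥ 1`.
    have h5 : 2 * (M + 1) * (α * ‖b‖ * (‖c‖ * P)) ≤ (M + 1) ^ 2 * (α * ‖b‖ * (‖c‖ * P)) := by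
      gcongr
      nlinarith
    linarith
  -- The estimate is a closed condition on `b`, so it passes from the dense set of elements with
  -- local units to all of `A`.
  · refine isClosed_le ?_ (by fun_prop)
    simp only [splitHead_apply]
    refine continuous_norm.comp (Continuous.sub ?_ ?_)
    · exact Ψ.cont.comp (continuous_pi (Fin.cases ι.continuous fun _ => continuous_const))
    · refine Ψ.cont.comp (continuous_pi (Fin.cases continuous_const
        (Fin.cases ?_ fun _ => continuous_const)))
      exact ι.continuous.mul continuous_const

theorem norm_splitAll_le {M r : ℝ} (hM : HasBoundedLocalUnits A M) (hM1 : 1 ≤ M)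
    (hr : HasStrongPropertyB.{u, w} A r) (hone : ‖(1 : B)‖ = 1) (ι : A →L[ℂ] B)
    (hι : ∀ a, ‖ι a‖ = ‖a‖) (hmul : ∀ a b, ι (a * b) = ι a * ι b)
    {k : ℕ} {α : ℝ} (hα : 0 ≤ α) {Ψ : BMul (k + 1) B X}
    (hΨ : BoundedOnZeroProducts α Ψ) (b : Fin k → A) :
    ‖splitAll k (fun i => ι (b i)) Ψ‖
      ≤ (M ^ 2 * r + (M + 1) ^ 2) ^ k * α * ∏ i, ‖b i‖ := by
  induction k generalizing α with
  | zero => simpa [splitAll, hone] using hΨ (fun _ => 1) (fun i => i.elim0)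
  | succ k ih =>
    have h0 := hr.1
    refine (ih (by positivity)
      (hΨ.splitHead hM hM1 hr hone ι hι hmul hα (b 0)) fun i => b i.succ).trans_eq ?_
    rw [Fin.prod_univ_succ]
    ring

end Split

/-! ### The two-sided map and its bar differential -/

section TwoSided

theorem contractNth_castSucc_snoc {B : Type u} [Mul B] {n : ℕ} (j : Fin n) (t : Fin (n + 1) → B)
    (c : B) :
    Fin.contractNth j.castSucc.castSucc (· * ·) (Fin.snoc t c : Fin (n + 2) → B)
      = Fin.snoc (Fin.contractNth j.castSucc (· * ·) t) c := by
  ext k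
  refine Fin.lastCases ?_ (fun k => ?_) k
  · have h1 : ¬ (n < (j : ℕ)) := by omega
    have h2 : ¬ (n = (j : ℕ)) := by omega
    simp [Fin.contractNth, h1, h2]
  · have h : k.castSucc.succ = k.succ.castSucc := rfl
    simp only [Fin.contractNth, Fin.val_castSucc, Fin.snoc_castSucc, h]

theorem contractNth_last_snoc_snoc {B : Type u} [Mul B] {n : ℕ} (t : Fin n → B) (b c : B) :
    Fin.contractNth (Fin.last n).castSucc (· * ·)
        (Fin.snoc (Fin.snoc t b : Fin (n + 1) → B) c : Fin (n + 2) → B)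
      = Fin.snoc t (b * c) := by
  ext k
  refine Fin.lastCases ?_ (fun k => ?_) k
  · simp [Fin.contractNth]
  · simp [Fin.contractNth]

variable {A : Type u} {X : Type v} [NonUnitalNormedRing A] [NormedSpace ℂ A]
  [NormedAddCommGroup X] [NormedSpace ℂ X] [BanachBimodule A X]

/-- The map `(a_0,…,a_{n+1}) ↦ a_0 T(a_1,…,a_n) a_{n+1}`. -/
noncomputable def twoSided {n : ℕ} (T : BMul n A X) : BMul (n + 2) A X :=
  deltaRight (deltaLeft T)

theorem twoSided_apply {n : ℕ} (T : BMul n A X) (x : Fin (n + 2) → A) :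
    twoSided T x = BanachBimodule.ract (x (Fin.last (n + 1)))
      (BanachBimodule.lact (x 0) (T fun i => x i.succ.castSucc)) := rfl

theorem twoSided_cons_snoc {n : ℕ} (T : BMul n A X) (a c : A) (t : Fin n → A) :
    twoSided T (Fin.cons a (Fin.snoc t c : Fin (n + 1) → A))
      = BanachBimodule.ract c (BanachBimodule.lact a (T t)) := by
  rw [twoSided_apply, ← Fin.succ_last, Fin.cons_succ, Fin.snoc_last, Fin.cons_zero]
  congr 3
  ext i
  rw [← Fin.succ_castSucc, Fin.cons_succ, Fin.snoc_castSucc]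

variable [IsScalarTower ℂ A A] [SMulCommClass ℂ A A]

/-- The outer terms of `δ` are contractions too: `(a t_0) T(…) c` and `a T(…) (t_n c)` are the first
and last terms of the bar differential. All signs of `δ` thus come from `bar`. -/
theorem bar_twoSided {n : ℕ} (T : BMul n A X) (a c : A) (t : Fin (n + 1) → A) :
    bar (n + 1) (twoSided T) (Fin.cons a (Fin.snoc t c : Fin (n + 2) → A))
      = BanachBimodule.ract c (BanachBimodule.lact a (delta A X n T t)) := by
  rw [bar_eq_sum, Fin.sum_univ_succ, Fin.sum_univ_castSucc, delta_apply]
  simp only [← Fin.succ_castSucc, contractNth_succ_cons, contractNth_castSucc_snoc,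
    twoSided_cons_snoc, Fin.castSucc_zero, Fin.val_zero, pow_zero, one_smul, Fin.val_succ,
    Fin.val_castSucc, Fin.val_last, map_add, map_sum, map_smul]
  rw [← add_assoc]
  congr 2
  · obtain ⟨b, s, rfl⟩ : ∃ (b : A) (s : Fin n → A), t = Fin.cons b s :=
      ⟨t 0, fun i => t i.succ, (Fin.cons_self_tail t).symm⟩
    rw [← Fin.cons_snoc_eq_snoc_cons (β := A), contractNth_zero_cons_cons, twoSided_cons_snoc,
      BanachBimodule.lact_mul]
    simp only [Fin.cons_zero, Fin.cons_succ]
  · obtain ⟨b, s, rfl⟩ : ∃ (b : A) (s : Fin n → A), t = Fin.snoc s b :=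
      ⟨t (Fin.last n), fun i => t i.castSucc, (Fin.snoc_init_self t).symm⟩
    rw [contractNth_last_snoc_snoc, twoSided_cons_snoc, BanachBimodule.ract_mul,
      Fin.snoc_last, BanachBimodule.lact_ract]
    simp only [Fin.snoc_castSucc]

theorem exists_cons_snoc {B : Type u} {n : ℕ} (x : Fin (n + 2) → B) :
    ∃ (a : B) (t : Fin n → B) (c : B), x = Fin.cons a (Fin.snoc t c : Fin (n + 1) → B) :=
  ⟨x 0, fun i => x i.castSucc.succ, x (Fin.last (n + 1)), by
    ext i
    refine Fin.cases rfl (fun i => ?_) i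
    refine Fin.lastCases ?_ (fun i => ?_) i <;> simp⟩

/-- By `bar_twoSided` the left side is an iterated bar differential, so `bar_bar` applies. The outer
factors disappear later, over a unital algebra. -/
theorem ract_lact_delta_delta {n : ℕ} (T : BMul n A X) (a c : A) (t : Fin (n + 2) → A) :
    BanachBimodule.ract c (BanachBimodule.lact a (delta A X (n + 1) (delta A X n T) t)) = 0 := by
  have h : (twoSided (delta A X n T) : (Fin (n + 3) → A) → X) = bar (n + 1) (twoSided T) := by
    funext x
    obtain ⟨a, t, c, rfl⟩ := exists_cons_snoc x
    rw [twoSided_cons_snoc, bar_twoSided]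
  rw [← bar_twoSided, h, bar_bar]

end TwoSided

/-! ### The unitization and its action -/

section Unitization

open WithLp

variable {A : Type u} {X : Type v} [NonUnitalNormedRing A] [NormedSpace ℂ A]
  [IsScalarTower ℂ A A] [SMulCommClass ℂ A A]

/-- The unitization of `A` with the `ℓ¹` norm. -/
abbrev UnitizationL1 (A : Type u) : Type u := WithLp 1 (Unitization ℂ A)

variable (A) in
/-- The inclusion of `A` in its unitization. -/
noncomputable def inrL : A →L[ℂ] UnitizationL1 A :=
  LinearMap.mkContinuous
    ((WithLp.linearEquiv 1 ℂ (Unitization ℂ A)).symm.toLinearMap ∘ₗ Unitization.inrHom ℂ ℂ A) 1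
    fun a => by rw [one_mul]; exact (unitization_norm_inr (𝕜 := ℂ) a).le

variable (A) in
/-- The scalar part of an element of the unitization. -/
noncomputable def fstL : UnitizationL1 A →L[ℂ] ℂ :=
  LinearMap.mkContinuous ((Unitization.fstHom ℂ A).toLinearMap.comp
    (WithLp.linearEquiv 1 ℂ (Unitization ℂ A)).toLinearMap) 1
    fun a => by
      rw [one_mul, unitization_norm_def]
      exact le_add_of_nonneg_right (norm_nonneg _)

variable (A) in
/-- The part in `A` of an element of the unitization. -/
noncomputable def sndL : UnitizationL1 A →L[ℂ] A :=
  LinearMap.mkContinuous ((Unitization.sndHom ℂ ℂ A).comp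
    (WithLp.linearEquiv 1 ℂ (Unitization ℂ A)).toLinearMap) 1
    fun a => by
      rw [one_mul, unitization_norm_def]
      exact le_add_of_nonneg_left (norm_nonneg _)

theorem norm_inrL (a : A) : ‖inrL A a‖ = ‖a‖ := unitization_norm_inr (𝕜 := ℂ) a

theorem inrL_mul (a b : A) : inrL A (a * b) = inrL A a * inrL A b := by
  refine (WithLp.equiv 1 (Unitization ℂ A)).injective ?_
  exact Unitization.inr_mul ℂ a b

theorem norm_eq_fstL_add_sndL (x : UnitizationL1 A) : ‖x‖ = ‖fstL A x‖ + ‖sndL A x‖ :=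
  unitization_norm_def x

theorem norm_sndL_le (x : UnitizationL1 A) : ‖sndL A x‖ ≤ ‖x‖ := by
  rw [norm_eq_fstL_add_sndL]; exact le_add_of_nonneg_left (norm_nonneg _)

theorem fstL_one : fstL A 1 = 1 := rfl

theorem sndL_one : sndL A 1 = 0 := rfl

theorem fstL_mul (x y : UnitizationL1 A) : fstL A (x * y) = fstL A x * fstL A y := rfl

theorem sndL_mul (x y : UnitizationL1 A) :
    sndL A (x * y) = fstL A x • sndL A y + fstL A y • sndL A x + sndL A x * sndL A y := rfl

theorem norm_one_unitizationL1 : ‖(1 : UnitizationL1 A)‖ = 1 := by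
  rw [norm_eq_fstL_add_sndL, fstL_one, sndL_one, norm_zero, norm_one, add_zero]

variable [NormedAddCommGroup X] [NormedSpace ℂ X]

/-- The extension of a multilinear map on `A` to the unitization by `0` at scalars. -/
noncomputable def extendZero {n : ℕ} (T : BMul n A X) : BMul n (UnitizationL1 A) X :=
  T.compContinuousLinearMap fun _ => sndL A

theorem extendZero_apply {n : ℕ} (T : BMul n A X) (x : Fin n → UnitizationL1 A) :
    extendZero T x = T fun i => sndL A (x i) := rfl

variable [BanachBimodule A X]

/-- A Banach bimodule is a Banach bimodule over the unitization. -/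
noncomputable instance UnitizationL1.banachBimodule : BanachBimodule (UnitizationL1 A) X where
  lact := (ContinuousLinearMap.lsmul ℂ ℂ).comp (fstL A) + BanachBimodule.lact.comp (sndL A)
  ract := (ContinuousLinearMap.lsmul ℂ ℂ).comp (fstL A) + BanachBimodule.ract.comp (sndL A)
  lact_mul x y v := by
    simp only [add_apply, ContinuousLinearMap.comp_apply, ContinuousLinearMap.lsmul_apply,
      fstL_mul, sndL_mul, map_add, map_smul, smul_apply, BanachBimodule.lact_mul, smul_add,
      mul_smul, smul_comm (fstL A y) (fstL A x)]
    abel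
  ract_mul x y v := by
    simp only [add_apply, ContinuousLinearMap.comp_apply, ContinuousLinearMap.lsmul_apply,
      fstL_mul, sndL_mul, map_add, map_smul, smul_apply, BanachBimodule.ract_mul, smul_add,
      mul_smul, smul_comm (fstL A x) (fstL A y)]
    abel
  lact_ract x y v := by
    simp only [add_apply, ContinuousLinearMap.comp_apply, ContinuousLinearMap.lsmul_apply,
      map_add, map_smul, BanachBimodule.lact_ract, smul_add,
      smul_comm (fstL A x) (fstL A y)]
    abel
  norm_lact_le x v := by
    rw [norm_eq_fstL_add_sndL, add_mul]
    refine (norm_add_le _ _).trans (add_le_add (norm_smul_le _ _) ?_)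
    exact BanachBimodule.norm_lact_le _ _
  norm_ract_le x v := by
    rw [norm_eq_fstL_add_sndL, mul_add]
    refine (norm_add_le _ _).trans (add_le_add ((norm_smul_le _ _).trans_eq (mul_comm _ _)) ?_)
    exact BanachBimodule.norm_ract_le _ _

theorem UnitizationL1.lact_apply (x : UnitizationL1 A) (v : X) :
    BanachBimodule.lact x v = fstL A x • v + BanachBimodule.lact (sndL A x) v := rfl

theorem UnitizationL1.ract_apply (x : UnitizationL1 A) (v : X) :
    BanachBimodule.ract x v = fstL A x • v + BanachBimodule.ract (sndL A x) v := rfl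

theorem UnitizationL1.lact_one (v : X) : BanachBimodule.lact (1 : UnitizationL1 A) v = v := by
  rw [UnitizationL1.lact_apply, fstL_one, sndL_one, map_zero, one_smul]; exact add_zero v

theorem UnitizationL1.ract_one (v : X) : BanachBimodule.ract (1 : UnitizationL1 A) v = v := by
  rw [UnitizationL1.ract_apply, fstL_one, sndL_one, map_zero, one_smul]; exact add_zero v

end Unitization

/-! ### Extension of cochains by zero at scalars -/

theorem sum_alternating_telescope {X : Type v} [AddCommGroup X] [Module ℂ X] {n : ℕ}
    (s : Fin (n + 1) → X) :
    ∑ j : Fin n, (-1 : ℂ) ^ ((j : ℕ) + 1) • (s j.castSucc + s j.succ)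
      = -s 0 + (-1 : ℂ) ^ n • s (Fin.last n) := by
  induction n with
  | zero => simp
  | succ n ih =>
    rw [Fin.sum_univ_castSucc]
    have := ih fun i => s i.castSucc
    simp only [Fin.castSucc_zero, Fin.val_castSucc, Fin.succ_castSucc] at this ⊢
    rw [this, Fin.val_last, pow_succ, Fin.succ_last]
    module

/-- A contraction becomes a change of one slot, to which multilinearity applies; filling that slot
with either factor amounts to deleting the other one. -/
theorem contractNth_eq_update {A : Type u} (op : A → A → A) {n : ℕ} (j : Fin n)
    (a : Fin (n + 1) → A) :
    (Fin.contractNth j.castSucc op a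
        = Function.update (fun i => a (j.castSucc.succAbove i)) j (op (a j.castSucc) (a j.succ))) ∧
      Function.update (fun i => a (j.castSucc.succAbove i)) j (a j.succ)
        = (fun i => a (j.castSucc.succAbove i)) ∧
      Function.update (fun i => a (j.castSucc.succAbove i)) j (a j.castSucc)
        = (fun i => a (j.succ.succAbove i)) := by
  refine ⟨?_, ?_, ?_⟩ <;> ext i <;> rcases lt_trichotomy i j with h | rfl | h
  · have h' : (i : ℕ) < j := h
    simp [Fin.contractNth, h', h.ne,
      Fin.succAbove_of_castSucc_lt _ _ (Fin.castSucc_lt_castSucc_iff.2 h)]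
  · simp [Fin.contractNth]
  · have h1 : ¬ (i : ℕ) < j := not_lt.2 (le_of_lt h)
    have h2 : ¬ (i : ℕ) = j := fun h' => h.ne' (Fin.ext h')
    simp [Fin.contractNth, h1, h2, h.ne',
      Fin.succAbove_of_le_castSucc _ _ (Fin.castSucc_le_castSucc_iff.2 h.le)]
  · simp [h.ne]
  · simp
  · simp [h.ne']
  · have h1 : i.castSucc < j.succ := Fin.castSucc_lt_succ_iff.2 h.le
    simp [h.ne,
      Fin.succAbove_of_castSucc_lt _ _ (Fin.castSucc_lt_castSucc_iff.2 h), Fin.succAbove_of_castSucc_lt _ _ h1]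
  · simp
  · have h1 : j.succ ≤ i.castSucc := Fin.succ_le_castSucc_iff.2 h
    simp [h.ne',
      Fin.succAbove_of_le_castSucc _ _ (Fin.castSucc_le_castSucc_iff.2 h.le), Fin.succAbove_of_le_castSucc _ _ h1]

variable {A : Type u} {X : Type v} [NonUnitalNormedRing A] [NormedSpace ℂ A]
  [IsScalarTower ℂ A A] [SMulCommClass ℂ A A] [NormedAddCommGroup X] [NormedSpace ℂ X]

theorem extendZero_contractNth {n : ℕ} (T : BMul n A X) (x : Fin (n + 1) → UnitizationL1 A)
    (j : Fin n) :
    extendZero T (Fin.contractNth j.castSucc (· * ·) x)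
      = T (Fin.contractNth j.castSucc (· * ·) fun i => sndL A (x i))
        + (fstL A (x j.castSucc) • T (fun i => sndL A (x (j.castSucc.succAbove i)))
          + fstL A (x j.succ) • T (fun i => sndL A (x (j.succ.succAbove i)))) := by
  obtain ⟨h1, h2, h3⟩ := contractNth_eq_update (· * ·) j fun i => sndL A (x i)
  have h : (fun i => sndL A (Fin.contractNth j.castSucc (· * ·) x i))
      = Function.update (fun i => sndL A (x (j.castSucc.succAbove i))) j
        (fstL A (x j.castSucc) • sndL A (x j.succ) + fstL A (x j.succ) • sndL A (x j.castSucc)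
          + sndL A (x j.castSucc) * sndL A (x j.succ)) := by
    rw [(contractNth_eq_update (· * ·) j x).1]
    ext i
    by_cases hi : i = j
    · subst hi; simp [sndL_mul]
    · simp [hi]
  rw [extendZero_apply, h, ContinuousMultilinearMap.map_update_add,
    ContinuousMultilinearMap.map_update_add, ContinuousMultilinearMap.map_update_smul,
    ContinuousMultilinearMap.map_update_smul, h1, h2, h3, add_comm]

variable [BanachBimodule A X]

/-- Each contraction yields scalar terms attached to the deletion of one of two neighbouring
arguments. Their alternating sum telescopes, and the two end terms cancel the scalar parts of the
outer actions. -/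
theorem delta_extendZero {n : ℕ} (T : BMul n A X) (x : Fin (n + 1) → UnitizationL1 A) :
    delta (UnitizationL1 A) X n (extendZero T) x = delta A X n T fun i => sndL A (x i) := by
  rw [delta_apply, delta_apply]
  simp only [extendZero_contractNth, smul_add (_ ^ _), Finset.sum_add_distrib]
  have h := sum_alternating_telescope
    fun j => fstL A (x j) • T fun i => sndL A (x (j.succAbove i))
  simp only [smul_add, Finset.sum_add_distrib] at h
  rw [h, UnitizationL1.lact_apply, UnitizationL1.ract_apply, extendZero_apply, extendZero_apply]
  simp only [Fin.zero_succAbove, Fin.succAbove_last, pow_succ]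
  module

theorem extendZero_mem_cocycles {n : ℕ} {S : BMul n A X} (hS : S ∈ cocycles A X n) :
    extendZero S ∈ cocycles (UnitizationL1 A) X n := by
  rw [cocycles, LinearMap.mem_ker] at hS ⊢
  ext x
  rw [delta_extendZero, hS]
  rfl

/-! ### The bound for `δⁿT` by `dist_r` -/

omit [IsScalarTower ℂ A A] [SMulCommClass ℂ A A] in
theorem twoSided_sub {n : ℕ} (S T : BMul n A X) (x : Fin (n + 2) → A) :
    twoSided (T - S) x = twoSided T x - twoSided S x := by
  simp [twoSided_apply]

omit [IsScalarTower ℂ A A] [SMulCommClass ℂ A A] in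
theorem norm_twoSided_le {n : ℕ} (T : BMul n A X) (x : Fin (n + 2) → A) :
    ‖twoSided T x‖ ≤ ‖x 0‖ * ‖x (Fin.last (n + 1))‖ * ‖T fun i => x i.succ.castSucc‖ := by
  rw [twoSided_apply]
  refine (BanachBimodule.norm_ract_le _ _).trans ?_
  calc _ ≤ (‖x 0‖ * ‖T fun i => x i.succ.castSucc‖) * ‖x (Fin.last (n + 1))‖ := by
        gcongr; exact BanachBimodule.norm_lact_le _ _
    _ = _ := by ring

/-- For a cocycle `S`, the element `a_0 S(a_1,…,a_n) a_{n+1}` vanishes as soon as all the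
consecutive products `a_i a_{i+1}` do. -/
theorem twoSided_eq_zero {n : ℕ} {S : BMul n A X} (hS : S ∈ cocycles A X n)
    (x : Fin (n + 2) → A) (hx : ∀ i : Fin (n + 1), x i.castSucc * x i.succ = 0) :
    twoSided S x = 0 := by
  rw [cocycles, LinearMap.mem_ker] at hS
  have h : delta A X n S (fun i => x i.castSucc) = 0 := by rw [hS]; rfl
  rw [delta_apply] at h
  rw [Finset.sum_eq_zero, add_zero] at h
  · rw [twoSided_apply]
    -- All inner terms of the cocycle identity contain a zero product. Acting by `x_{n+1}` on the
    -- right also kills the last term, through `x_n x_{n+1} = 0`.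
    have h' := congrArg (BanachBimodule.ract (x (Fin.last (n + 1)))) h
    rw [map_add, map_smul, ← BanachBimodule.ract_mul, ← Fin.succ_last, hx, map_zero, map_zero]
      at h'
    simpa using h'
  · intro j _
    rw [S.map_coord_zero j, smul_zero]
    rw [(contractNth_eq_update (· * ·) j _).1, Function.update_self]
    exact hx j.castSucc

-- Homogeneity in each variable reduces to unit vectors. Tuples with a zero entry cannot be
-- normalised, but there both sides vanish.
omit [BanachBimodule A X] [IsScalarTower ℂ A A] [SMulCommClass ℂ A A] in
theorem iInf_norm_sub_le_distR {n : ℕ} (T : BMul n A X) (𝒮 : Submodule ℂ (BMul n A X))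
    (a : Fin n → A) : ⨅ S : 𝒮, ‖T a - S.1 a‖ ≤ distR T 𝒮 * ∏ i, ‖a i‖ := by
  have hbdd : ∀ a : Fin n → A, BddBelow (Set.range fun S : 𝒮 => ‖T a - S.1 a‖) := fun a =>
    ⟨0, by rintro _ ⟨S, rfl⟩; exact norm_nonneg _⟩
  by_cases h : ∃ i, a i = 0
  · obtain ⟨i, hi⟩ := h
    rw [Finset.prod_eq_zero (Finset.mem_univ i) (by rw [hi, norm_zero]), mul_zero]
    refine (ciInf_le (hbdd a) 0).trans ?_
    simp [T.map_coord_zero i hi]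
  push Not at h
  have hc : ∀ i, ‖((‖a i‖⁻¹ : ℝ) : ℂ) • a i‖ = 1 := fun i => by
    rw [norm_smul, Complex.norm_real, norm_inv, norm_norm,
      inv_mul_cancel₀ (norm_ne_zero_iff.2 (h i))]
  have hle : ⨅ S : 𝒮, ‖T (fun i => ((‖a i‖⁻¹ : ℝ) : ℂ) • a i)
      - S.1 (fun i => ((‖a i‖⁻¹ : ℝ) : ℂ) • a i)‖ ≤ distR T 𝒮 := by
    refine le_ciSup (f := fun x : {x : Fin n → A // ∀ i, ‖x i‖ ≤ 1} =>
      ⨅ S : 𝒮, ‖T x.1 - S.1 x.1‖) ?_ ⟨_, fun i => (hc i).le⟩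
    refine ⟨‖T‖, ?_⟩
    rintro _ ⟨x, rfl⟩
    refine (ciInf_le (hbdd x.1) 0).trans ?_
    have h1 : ∏ i, ‖x.1 i‖ ≤ 1 := Finset.prod_le_one (fun i _ => norm_nonneg _) fun i _ => x.2 i
    simpa using (T.le_opNorm x.1).trans (mul_le_of_le_one_right (norm_nonneg _) h1)
  have hP : 0 ≤ ∏ i, ‖a i‖ := Finset.prod_nonneg fun i _ => norm_nonneg _
  refine le_trans (le_of_eq ?_) (mul_le_mul_of_nonneg_right hle hP)
  rw [Real.iInf_mul_of_nonneg hP]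
  congr 1
  ext S
  rw [← sub_apply, ← sub_apply, ContinuousMultilinearMap.map_smul_univ, norm_smul, norm_prod,
    mul_right_comm, ← Finset.prod_mul_distrib]
  rw [Finset.prod_eq_one, one_mul]
  intro i _
  rw [Complex.norm_real, norm_inv, norm_norm, inv_mul_cancel₀ (norm_ne_zero_iff.2 (h i))]

omit [BanachBimodule A X] [IsScalarTower ℂ A A] [SMulCommClass ℂ A A] in
theorem distR_nonneg {n : ℕ} (T : BMul n A X) (𝒮 : Submodule ℂ (BMul n A X)) :
    0 ≤ distR T 𝒮 :=
  Real.iSup_nonneg fun _ => Real.iInf_nonneg fun _ => norm_nonneg _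

theorem boundedOnZeroProducts_twoSided {n : ℕ} (T : BMul n A X) :
    BoundedOnZeroProducts (distR T (cocycles A X n)) (twoSided (extendZero T)) := by
  intro x hx
  have h1 : ∀ S : cocycles A X n, ‖twoSided (extendZero T) x‖
      ≤ ‖x 0‖ * ‖x (Fin.last (n + 1))‖ *
        ‖T (fun i => sndL A (x i.succ.castSucc)) - S.1 fun i => sndL A (x i.succ.castSucc)‖ := by
    intro S
    -- `S` may depend on `x`, as its own contribution at `x` is zero; hence the infimum can be taken
    -- tuple by tuple.
    have h := norm_twoSided_le (extendZero T - extendZero S.1) x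
    rwa [twoSided_sub, twoSided_eq_zero (extendZero_mem_cocycles S.2) x hx, sub_zero] at h
  have h2 : ‖twoSided (extendZero T) x‖ ≤ ‖x 0‖ * ‖x (Fin.last (n + 1))‖ *
      ⨅ S : cocycles A X n,
        ‖T (fun i => sndL A (x i.succ.castSucc)) - S.1 fun i => sndL A (x i.succ.castSucc)‖ := by
    rw [Real.mul_iInf_of_nonneg (by positivity)]
    exact le_ciInf h1
  refine h2.trans ?_
  have h0 := distR_nonneg T (cocycles A X n)
  calc _ ≤ ‖x 0‖ * ‖x (Fin.last (n + 1))‖ * (distR T (cocycles A X n)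
          * ∏ i : Fin n, ‖sndL A (x i.succ.castSucc)‖) := by
        gcongr; exact iInf_norm_sub_le_distR _ _ _
    _ ≤ ‖x 0‖ * ‖x (Fin.last (n + 1))‖ * (distR T (cocycles A X n)
          * ∏ i : Fin n, ‖x i.succ.castSucc‖) := by
        gcongr; exact norm_sndL_le _
    _ = distR T (cocycles A X n) * ∏ i, ‖x i‖ := by
        rw [Fin.prod_univ_succ, Fin.prod_univ_castSucc]
        simp only [Fin.succ_last, Fin.succ_castSucc]
        ring

theorem delta_eq_splitAll {n : ℕ} (T : BMul n A X) (b : Fin (n + 1) → A) :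
    delta A X n T b = splitAll (n + 1) (fun i => inrL A (b i)) (twoSided (extendZero T)) := by
  rw [splitAll_eq_bar, bar_twoSided, UnitizationL1.lact_one, UnitizationL1.ract_one,
    delta_extendZero]
  · rfl
  · intro x i hi hil hx
    obtain ⟨j, rfl⟩ := Fin.exists_castSucc_eq.mpr hil
    obtain ⟨k, rfl⟩ := Fin.exists_succ_eq.mpr (fun h : j = 0 => hi (by rw [h]; rfl))
    rw [twoSided_apply, extendZero_apply, T.map_coord_zero k, map_zero, map_zero]
    rw [hx, sndL_one]

theorem norm_delta_le {M r : ℝ} (hM : HasBoundedLocalUnits A M) (hM1 : 1 ≤ M)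
    (hr : HasStrongPropertyB.{u, w} A r) {n : ℕ} (T : BMul n A X) :
    ‖delta A X n T‖ ≤ (M ^ 2 * r + (M + 1) ^ 2) ^ (n + 1) * distR T (cocycles A X n) := by
  have h0 := hr.1
  have h1 := distR_nonneg T (cocycles A X n)
  refine ContinuousMultilinearMap.opNorm_le_bound (by positivity) fun b => ?_
  rw [delta_eq_splitAll]
  exact norm_splitAll_le hM hM1 hr norm_one_unitizationL1 (inrL A) norm_inrL inrL_mul
    h1 (boundedOnZeroProducts_twoSided T) b

/-! ### Closed range and the open mapping constant -/

theorem delta_delta {n : ℕ} (T : BMul n A X) : delta A X (n + 1) (delta A X n T) = 0 := by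
  have h : delta (UnitizationL1 A) X n (extendZero T) = extendZero (delta A X n T) := by
    ext x; exact delta_extendZero T x
  ext t
  have h1 := ract_lact_delta_delta (extendZero T) 1 1 fun i => inrL A (t i)
  rw [UnitizationL1.lact_one, UnitizationL1.ract_one, h, delta_extendZero] at h1
  exact h1

/-- By the closed graph theorem it suffices to compare values at each tuple, and these depend
continuously on `T`. -/
theorem continuous_delta [CompleteSpace X] (n : ℕ) : Continuous (delta A X n) := by
  refine LinearMap.continuous_of_seq_closed_graph _ fun T T₀ S hT hS => ?_
  ext a
  have hev : ∀ {m : ℕ} (b : Fin m → A), Continuous fun T : BMul m A X => T b := fun b =>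
    (ContinuousMultilinearMap.apply ℂ _ X b).continuous
  have h1 := ((hev a).tendsto S).comp hS
  have hc : Continuous fun T : BMul n A X => delta A X n T a := by
    simp only [delta_apply]
    refine ((ContinuousLinearMap.continuous _).comp (hev _)).add
      (continuous_finsetSum _ fun j _ => (hev _).const_smul _) |>.add
      (((ContinuousLinearMap.continuous _).comp (hev _)).const_smul _)
  exact tendsto_nhds_unique h1 ((hc.tendsto T₀).comp hT)

/-- The coboundaries are the preimage of the closed point `0` of the Hausdorff quotient, hence
closed in the cocycles, which form the closed kernel of the next `δ`. -/
theorem isClosed_range_delta [CompleteSpace X] (n : ℕ) (hH : T2Space (CohomologySucc A X n)) :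
    IsClosed (LinearMap.range (delta A X n) : Set (BMul (n + 1) A X)) := by
  have h1 : IsClosed (coboundaries A X n : Set (cocycles A X (n + 1))) := by
    have h : (coboundaries A X n : Set (cocycles A X (n + 1)))
        = (coboundaries A X n).mkQ ⁻¹' {0} := by
      ext x; simp [Submodule.Quotient.mk_eq_zero]
    have h0 : IsClosed ({0} : Set (CohomologySucc A X n)) := isClosed_singleton
    rw [h]
    exact h0.preimage continuous_quot_mk
  have h2 : IsClosed (cocycles A X (n + 1) : Set (BMul (n + 1) A X)) :=
    isClosed_singleton.preimage (continuous_delta (n + 1))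
  have h3 := h2.isClosedMap_subtype_val _ h1
  convert h3
  ext S
  constructor
  · rintro ⟨T, rfl⟩
    exact ⟨⟨_, delta_delta T⟩, ⟨T, rfl⟩, rfl⟩
  · rintro ⟨S, hS, rfl⟩
    exact hS

theorem exists_isOpenMappingConstant [CompleteSpace X] (n : ℕ)
    (hH : T2Space (CohomologySucc A X n)) : ∃ C : ℝ, 0 < C ∧ IsOpenMappingConstant A X n C := by
  let D : BMul n A X →L[ℂ] BMul (n + 1) A X := ⟨delta A X n, continuous_delta n⟩
  have hsurj : Function.Surjective D.rangeRestrict := by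
    rintro ⟨_, T, rfl⟩
    exact ⟨T, rfl⟩
  have : CompleteSpace D.range :=
    (isClosed_range_delta n hH).completeSpace_coe
  obtain ⟨C, hC, h⟩ := ContinuousLinearMap.exists_preimage_norm_le (E := BMul n A X) (F := D.range)
    (σ := RingHom.id ℂ) D.rangeRestrict hsurj
  refine ⟨C, hC, fun T => ?_⟩
  obtain ⟨S, hS, hSC⟩ := h (D.rangeRestrict T)
  have hS' : delta A X n S = delta A X n T := congrArg Subtype.val hS
  have hmem : T - S ∈ cocycles A X n := by
    rw [cocycles, LinearMap.mem_ker, map_sub, hS', sub_self]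
  refine (Metric.infDist_le_dist_of_mem hmem).trans ?_
  rw [dist_eq_norm, sub_sub_cancel]
  exact hSC

omit [IsScalarTower ℂ A A] [SMulCommClass ℂ A A] [NormedSpace ℂ A] in
theorem HasBoundedLocalUnits.one_le [Nontrivial A] {M : ℝ} (hM : HasBoundedLocalUnits A M) :
    1 ≤ M := by
  obtain ⟨a, ⟨e, he, hea, -⟩, ha⟩ := hM.exists_mem_open (isOpen_compl_singleton (x := (0 : A)))
    (exists_ne 0)
  have h : ‖a‖ ≤ ‖e‖ * ‖a‖ := by
    conv_lhs => rw [← hea]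
    exact norm_mul_le _ _
  exact (le_of_mul_le_mul_right (by rwa [one_mul]) (norm_pos_iff.2 ha)).trans he

omit [IsScalarTower ℂ A A] [SMulCommClass ℂ A A] [BanachBimodule A X] in
theorem distR_eq_zero_of_mem {n : ℕ} {T : BMul n A X} {𝒮 : Submodule ℂ (BMul n A X)}
    (hT : T ∈ 𝒮) : distR T 𝒮 = 0 := by
  refine le_antisymm (Real.iSup_le (fun x => ?_) le_rfl) (distR_nonneg T 𝒮)
  refine (ciInf_le ⟨0, ?_⟩ ⟨T, hT⟩).trans (by simp)
  rintro _ ⟨S, rfl⟩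
  exact norm_nonneg _

theorem infDist_cocycles_le {M r : ℝ} (hM : HasBoundedLocalUnits A M)
    (hr : HasStrongPropertyB.{u, w} A r) {n : ℕ} {C : ℝ} (hC : IsOpenMappingConstant A X n C)
    (T : BMul n A X) :
    Metric.infDist T (cocycles A X n : Set (BMul n A X))
      ≤ C * 2 ^ (n - 1) * (M ^ 2 * r + (M + 1) ^ 2) ^ (n + 1) * distR T (cocycles A X n) := by
  -- For a cocycle both sides are zero, whatever the sign of `C`. Otherwise (1) forces `C ≥ 0`, and
  -- `A` is nontrivial, which gives `M ≥ 1`.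
  by_cases hT : delta A X n T = 0
  · rw [Metric.infDist_zero_of_mem (show T ∈ (cocycles A X n : Set _) from hT),
      distR_eq_zero_of_mem (show T ∈ cocycles A X n from hT), mul_zero]
  have hpos : 0 < ‖delta A X n T‖ := norm_pos_iff.2 hT
  have hC0 : 0 ≤ C := nonneg_of_mul_nonneg_left (Metric.infDist_nonneg.trans (hC T)) hpos
  have : Nontrivial A := by
    by_contra h
    rw [not_nontrivial_iff_subsingleton] at h
    exact hT (by ext a; exact (delta A X n T).map_coord_zero 0 (Subsingleton.elim _ _))
  have h0 := hr.1
  have h1 := distR_nonneg T (cocycles A X n)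
  calc _ ≤ C * ‖delta A X n T‖ := hC T
    _ ≤ C * ((M ^ 2 * r + (M + 1) ^ 2) ^ (n + 1) * distR T (cocycles A X n)) := by
        gcongr; exact norm_delta_le hM hM.one_le hr T
    _ = C * 1 * (M ^ 2 * r + (M + 1) ^ 2) ^ (n + 1) * distR T (cocycles A X n) := by ring
    -- The argument gives the bound with `1` in place of `2^(n-1)`.
    _ ≤ _ := by
        gcongr
        exact one_le_pow₀ one_le_two

end BoundedCocycle

/-- The quotient seminorm on `ℋ^{n+1}(A, X)` is automatically complete, so that this space is a
Banach space exactly when it is Hausdorff. -/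
theorem mainTheorem3 (A : Type u) [NonUnitalNormedRing A] [NormedSpace ℂ A]
    [IsScalarTower ℂ A A] [SMulCommClass ℂ A A] [CompleteSpace A]
    (X : Type v) [NormedAddCommGroup X] [NormedSpace ℂ X] [CompleteSpace X]
    [BoundedCocycle.BanachBimodule A X]
    (M r : ℝ) (hM : BoundedCocycle.HasBoundedLocalUnits A M)
    (hr : BoundedCocycle.HasStrongPropertyB.{u, w} A r)
    (n : ℕ) (hn : 1 ≤ n)
    (hH : T2Space (BoundedCocycle.CohomologySucc A X n)) :
    (∃ C : ℝ, 0 < C ∧ BoundedCocycle.IsOpenMappingConstant A X n C) ∧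
    (∀ C : ℝ, BoundedCocycle.IsOpenMappingConstant A X n C →
      ∀ T : BoundedCocycle.BMul n A X,
        Metric.infDist T (BoundedCocycle.cocycles A X n : Set (BoundedCocycle.BMul n A X))
          ≤ C * 2 ^ (n - 1) * (M ^ 2 * r + (M + 1) ^ 2) ^ (n + 1)
            * BoundedCocycle.distR T (BoundedCocycle.cocycles A X n)) ∧
    BoundedCocycle.IsHyperreflexive (BoundedCocycle.cocycles A X n) := by
  obtain ⟨C, hC0, hC⟩ := BoundedCocycle.exists_isOpenMappingConstant n hH
  exact ⟨⟨C, hC0, hC⟩, fun C hC T => BoundedCocycle.infDist_cocycles_le hM hr hC T,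
    _, BoundedCocycle.infDist_cocycles_le hM hr hC⟩
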